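/- Let $n\in\mathbb{N}=\{1,2,3,\dots\}$ and $\mathbb{Z}_n=\mathbb{Z}/n\mathbb{Z}$. A \emph{reversible square matrix} is a matrix $M=(M_{i,j})_{i,j\in\mathbb{Z}_n}\in\mathbb{R}^{n\times n}$ (indices are residues modulo $n$, the top left corner has indices $(1,1)$) such that, for all $i,j,k,l\in\mathbb{Z}_n$, \[ M_{i,j}+M_{i,n+1-j}=M_{i,k}+M_{i,n+1-k},\qquad M_{i,j}+M_{n+1-i,j}=M_{k,j}+M_{n+1-k,j},\qquad M_{i,j}+M_{k,l}=M_{i,l}+M_{k,j}. \] An $n\times n$ \emph{principal reversible square} is a reversible square matrix $M$ such that $\{M_{i,j}\mid i,j\in\mathbb{Z}_n\}=\{1,2,\dots,n^2\}$, the entries in each row and in each column, read along the indices $1,2,\dots,n$, are in increasing order, and $M_{1,1}=1$, $M_{1,2}=2$. Let $N_n$ be the number of different $n\times n$ principal reversible squares. (For $n=1$ the indices $1$ and $2$ coincide, so there is no principal reversible square and $N_1=0$.) Then, for every $n\in\mathbb{N}$, $N_n=1$ if and only if $n$ is prime. -/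

import Mathlib

/-- A reversible square matrix: an `n × n` real matrix, with rows and columns indexed by the
cyclic ring `ℤ/nℤ` (the top left corner having indices `(1, 1)`), that has the row and column
reversal symmetry and the vertex cross sum property. -/
structure IsReversibleSquare {n : ℕ} (M : Matrix (ZMod n) (ZMod n) ℝ) : Prop where
  row_reversal : ∀ i j k : ZMod n, M i j + M i (n + 1 - j) = M i k + M i (n + 1 - k)
  col_reversal : ∀ i j k : ZMod n, M i j + M (n + 1 - i) j = M k j + M (n + 1 - k) j
  cross_sum : ∀ i j k l : ZMod n, M i j + M k l = M i l + M k j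

/-- A principal reversible square: a reversible square matrix whose set of entries is
`{1, 2, …, n²}`, whose rows and columns (read along the indices `1, 2, …, n`) are increasing,
and whose entries at `(1, 1)` and `(1, 2)` are `1` and `2`. Indices are residues modulo `n`, so
for `n = 1` the last two conditions contradict each other. -/
structure IsPrincipalReversibleSquare {n : ℕ} (M : Matrix (ZMod n) (ZMod n) ℝ) : Prop
    extends IsReversibleSquare M where
  entries : {x : ℝ | ∃ i j : ZMod n, x = M i j} = {x : ℝ | ∃ m : ℕ, 1 ≤ m ∧ m ≤ n ^ 2 ∧ x = m}
  row_increasing : ∀ i : ZMod n, ∀ a b : ℕ, 1 ≤ a → a < b → b ≤ n → M i a < M i b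
  col_increasing : ∀ j : ZMod n, ∀ a b : ℕ, 1 ≤ a → a < b → b ≤ n → M a j < M b j
  first_entry : M 1 1 = 1
  second_entry : M 1 2 = 2

/-- `N_n`, the number of different `n × n` principal reversible squares. -/
noncomputable def numPrincipalReversibleSquares (n : ℕ) : ℕ :=
  {M : Matrix (ZMod n) (ZMod n) ℝ | IsPrincipalReversibleSquare M}.ncard

/-! By the cross sum property and `M 1 1 = 1`, `M i j - 1 = f i + g j` with `f` the first column and
`g` the first row, both lowered by 1. So `[0, n²)` is a direct sum of two `n`-element sets, the
second containing 1. For `n = p` prime, the generating polynomials of these sets multiply to `Φ_p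
Φ_{p²}`. Both have value `p` at 1, so irreducibility leaves only this factorization, and the term
`X` decides the order (`eq_of_bijOn_add`). In general each divisor `a ≥ 2` of `n` yields a square,
by mixed-radix expansion; a proper one yields a square other than that of `a = n`. -/

open Polynomial in
/-- If a product of two 0-1 polynomials `∑ X ^ f i` and `∑ X ^ g j` with `p` terms each is
`1 + X + ⋯ + X ^ (p ^ 2 - 1)`, then the factor containing `X` is the cyclotomic polynomial
`Φ_p` and the other one is `Φ_{p²}`. -/
theorem factors_eq_cyclotomic {p : ℕ} (hp : p.Prime) {A B : ℤ[X]}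
    (hAB : A * B = ∑ k ∈ Finset.range (p ^ 2), X ^ k)
    (hA : A.eval 1 = p) (hB : B.eval 1 = p) (hB1 : B.coeff 1 ≠ 0) :
    B = ∑ k ∈ Finset.range p, X ^ k ∧ A = ∑ k ∈ Finset.range p, X ^ (p * k) := by
  have : Fact p.Prime := ⟨hp⟩
  have h1 : cyclotomic p ℤ = ∑ k ∈ Finset.range p, X ^ k := cyclotomic_prime ℤ p
  have h2 : cyclotomic (p ^ 2) ℤ = ∑ k ∈ Finset.range p, X ^ (p * k) := by
    simpa [← pow_mul] using cyclotomic_prime_pow_eq_geom_sum (R := ℤ) (n := 1) hp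
  have hprod : A * B = cyclotomic p ℤ * cyclotomic (p ^ 2) ℤ := by
    have hX : (X - 1 : ℤ[X]) ≠ 0 := X_sub_C_ne_zero (1 : ℤ)
    apply mul_right_cancel₀ hX
    have hgeom : (∑ k ∈ Finset.range p, (X : ℤ[X]) ^ (p * k)) * (X ^ p - 1) = X ^ p ^ 2 - 1 := by
      simpa [← pow_mul, sq] using geom_sum_mul ((X : ℤ[X]) ^ p) p
    rw [hAB, geom_sum_mul, h1, h2, ← hgeom, ← geom_sum_mul (X : ℤ[X]) p]
    ring
  have hp0 : (p : ℤ) ≠ 0 := by exact_mod_cast hp.ne_zero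
  have hpu : ¬ IsUnit (p : ℤ) := by
    rw [Int.isUnit_iff_natAbs_eq]
    simpa using hp.one_lt.ne'
  have e1 : (cyclotomic p ℤ).eval 1 = p := by simp [h1, eval_finsetSum]
  have e2 : (cyclotomic (p ^ 2) ℤ).eval 1 = p := by simp [h2, eval_finsetSum]
  have key : ∀ P Q : ℤ[X], P * Q = cyclotomic p ℤ * cyclotomic (p ^ 2) ℤ →
      P.eval 1 = p → Q.eval 1 = p → cyclotomic p ℤ ∣ P →
      P = cyclotomic p ℤ ∧ Q = cyclotomic (p ^ 2) ℤ := by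
    rintro P Q hPQ hP hQ ⟨C, rfl⟩
    have hC : C * Q = cyclotomic (p ^ 2) ℤ :=
      mul_left_cancel₀ (cyclotomic_ne_zero p ℤ) (by rw [← hPQ, mul_assoc])
    -- A unit `C` is a constant, equal to 1 by evaluation at 1; a unit `Q` would make `Q(1) = p` a
    -- unit of `ℤ`.
    rcases (cyclotomic.irreducible (pow_pos hp.pos 2)).isUnit_or_isUnit hC.symm with hu | hu
    · obtain ⟨c, -, rfl⟩ := isUnit_iff.1 hu
      rw [eval_mul, e1, eval_C] at hP
      have hc : c = 1 := mul_left_cancel₀ hp0 (by rw [hP, mul_one])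
      subst hc
      simpa using hC
    · exact absurd (hQ ▸ hu.map (evalRingHom (1 : ℤ))) hpu
  have hprime : Prime (cyclotomic p ℤ) := (cyclotomic.irreducible hp.pos).prime
  rcases hprime.dvd_or_dvd (Dvd.intro _ hprod.symm) with h | h
  -- Here `B` would be `Φ_{p²}`, whose exponents are all multiples of `p`.
  · obtain ⟨-, hB'⟩ := key A B hprod hA hB h
    refine absurd ?_ hB1
    rw [hB', h2, finsetSum_coeff]
    refine Finset.sum_eq_zero fun k _ => ?_
    rw [coeff_X_pow, if_neg]
    intro hk
    exact hp.one_lt.ne' (Nat.eq_one_of_mul_eq_one_right hk.symm)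
  · obtain ⟨hB', hA'⟩ := key B A (by rw [mul_comm, hprod]) hB hA h
    exact ⟨hB'.trans h1, hA'.trans h2⟩

open Polynomial in
/-- A strictly increasing sequence is determined by its generating polynomial. -/
theorem strictMono_eq_of_sum_X_pow_eq {n : ℕ} {f g : Fin n → ℕ} (hf : StrictMono f)
    (hg : StrictMono g) (h : ∑ i, (X : ℤ[X]) ^ f i = ∑ i, X ^ g i) : f = g := by
  have hcoeff : ∀ {f : Fin n → ℕ}, StrictMono f → ∀ m,
      (∑ i, (X : ℤ[X]) ^ f i).coeff m ≠ 0 ↔ m ∈ Set.range f := by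
    intro f hf m
    simp only [finsetSum_coeff, coeff_X_pow, Finset.sum_boole, ne_eq, Nat.cast_eq_zero,
      Finset.card_eq_zero, Finset.filter_eq_empty_iff, Finset.mem_univ, true_implies, not_forall,
      not_not, Set.mem_range, eq_comm (a := m)]
  refine (hf.range_inj hg).1 (Set.ext fun m => ?_)
  rw [← hcoeff hf, ← hcoeff hg, h]

open Polynomial in
/-- For `p` prime, the only way to write the interval `[0, p²)` as a direct sum of two
`p`-element sets, the second one containing `1`, is `{0, p, …, (p - 1) p} + {0, 1, …, p - 1}`. -/
theorem eq_of_bijOn_add {p : ℕ} (hp : p.Prime) {f g : Fin p → ℕ} (hf : StrictMono f)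
    (hg : StrictMono g) (hg1 : ∃ j, g j = 1)
    (hlt : ∀ i j, f i + g j < p ^ 2) (hsurj : ∀ m < p ^ 2, ∃ i j, f i + g j = m) :
    (∀ i, f i = p * i) ∧ ∀ j, g j = j := by
  let F : Fin p × Fin p → ℕ := fun x => f x.1 + g x.2
  have himage : Finset.univ.image F = Finset.range (p ^ 2) := by
    ext m
    simp only [Finset.mem_image, Finset.mem_univ, true_and, Prod.exists, Finset.mem_range]
    exact ⟨by rintro ⟨i, j, rfl⟩; exact hlt i j, hsurj m⟩
  -- The `p²` pairs cover `p²` values, so each sum occurs only once.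
  have hinj : Set.InjOn F (Finset.univ : Finset (Fin p × Fin p)) := by
    apply Finset.card_image_iff.1
    rw [himage]
    simp [sq]
  have hAB : (∑ i, (X : ℤ[X]) ^ f i) * ∑ j, X ^ g j = ∑ k ∈ Finset.range (p ^ 2), X ^ k := by
    rw [← himage, Finset.sum_image hinj, Finset.sum_mul_sum, ← Finset.univ_product_univ,
      Finset.sum_product]
    simp only [F, pow_add]
  have hB1 : (∑ j, (X : ℤ[X]) ^ g j).coeff 1 ≠ 0 := by
    obtain ⟨j, hj⟩ := hg1
    simp only [finsetSum_coeff, coeff_X_pow, Finset.sum_boole, ne_eq, Nat.cast_eq_zero,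
      Finset.card_eq_zero, Finset.filter_eq_empty_iff, not_forall]
    exact ⟨j, Finset.mem_univ j, not_not.2 hj.symm⟩
  obtain ⟨hB, hA⟩ := factors_eq_cyclotomic hp hAB (by simp [eval_finsetSum])
    (by simp [eval_finsetSum]) hB1
  rw [Finset.sum_range] at hA hB
  have hid : StrictMono fun i : Fin p => (i : ℕ) := fun _ _ h => h
  have hmul : StrictMono fun i : Fin p => p * (i : ℕ) := hid.const_mul hp.pos
  exact ⟨congrFun (strictMono_eq_of_sum_X_pow_eq hf hmul hA),
    congrFun (strictMono_eq_of_sum_X_pow_eq hg hid hB)⟩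

/-- The position, counted from `0`, of an index in the order `1, 2, …, n`. -/
def position {n : ℕ} (x : ZMod n) : ℕ := (x - 1).val

theorem position_lt {n : ℕ} [NeZero n] (x : ZMod n) : position x < n := ZMod.val_lt _

theorem position_natCast_succ {n k : ℕ} (hk : k < n) :
    position ((k + 1 : ℕ) : ZMod n) = k := by
  simp [position, ZMod.val_natCast_of_lt hk]

theorem natCast_position_succ {n : ℕ} [NeZero n] (x : ZMod n) :
    ((position x + 1 : ℕ) : ZMod n) = x := by
  simp [position]

theorem position_reverse {n : ℕ} [NeZero n] (x : ZMod n) :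
    position ((n : ZMod n) + 1 - x) = n - 1 - position x := by
  have hx := position_lt x
  have h : ((n - 1 - position x + 1 : ℕ) : ZMod n) = n + 1 - x := by
    rw [show n - 1 - position x + 1 = n - position x by omega, Nat.cast_sub hx.le]
    simp [position]
  rw [← h, position_natCast_succ (by omega)]

/-- For `a ∣ n`, the column offsets `{0, …, a - 1} + a n {0, …, n / a - 1}` in increasing order. -/
def columnOffset (n a t : ℕ) : ℕ := t % a + a * n * (t / a)

theorem columnOffset_strictMono {n a : ℕ} (hn : 0 < n) (ha : 0 < a) :
    StrictMono (columnOffset n a) := by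
  intro s t hst
  have hs := Nat.mod_lt s ha
  rcases (Nat.div_le_div_right hst.le : s / a ≤ t / a).eq_or_lt with h | h
  · have h1 := Nat.mod_add_div s a
    have h2 := Nat.mod_add_div t a
    simp only [columnOffset, h] at h1 ⊢
    omega
  · have h1 : a * n * (s / a + 1) ≤ a * n * (t / a) := Nat.mul_le_mul_left _ h
    have h2 : a * 1 ≤ a * n := Nat.mul_le_mul_left _ hn
    simp only [columnOffset]
    rw [mul_add] at h1
    omega

/-- Reversal complements both digits of `t = r + a * q`: `r` becomes `a - 1 - r` and `q` becomes `b
- 1 - q`. -/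
theorem columnOffset_add_reverse {n a b t : ℕ} (hn : n = a * b) (ht : t < n) :
    columnOffset n a t + columnOffset n a (n - 1 - t) = (a - 1) + a * n * (b - 1) := by
  have ha : 0 < a := Nat.pos_of_ne_zero (by rintro rfl; simp_all)
  have hr := Nat.mod_lt t ha
  have hq : t / a < b := Nat.div_lt_of_lt_mul (hn ▸ ht)
  have hdecomp := Nat.mod_add_div t a
  obtain ⟨c, hc⟩ : ∃ c, b = t / a + 1 + c := ⟨_, (Nat.add_sub_of_le hq).symm⟩
  have hrev : n - 1 - t = (a - 1 - t % a) + a * c := by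
    have : n = a * (t / a) + a + a * c := by rw [hn, hc]; ring
    omega
  have hlt : a - 1 - t % a < a := by omega
  have hb : b - 1 = t / a + c := by rw [hc, Nat.add_right_comm, Nat.add_sub_cancel]
  rw [hrev, columnOffset, columnOffset, Nat.add_mul_mod_self_left, Nat.mod_eq_of_lt hlt,
    Nat.add_mul_div_left _ _ ha, Nat.div_eq_of_lt hlt, hb, zero_add, mul_add]
  omega

/-- The reversible square attached to a divisor `a` of `n`. -/
noncomputable def divisorSquare (n a : ℕ) : Matrix (ZMod n) (ZMod n) ℝ := fun i j =>
  ((1 + a * position i + columnOffset n a (position j) : ℕ) : ℝ)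

/-- With `n = a * b`, an entry minus 1 is `r + a * i + a * n * q` with `r < a`, `i < n`, `q < b`: a
mixed-radix expansion of the numbers below `n²`. As `a ≥ 2`, the second column has offset 1. -/
theorem divisorSquare_isPrincipal {n a : ℕ} (hn : 0 < n) (ha : 2 ≤ a) (hdvd : a ∣ n) :
    IsPrincipalReversibleSquare (divisorSquare n a) := by
  have : NeZero n := ⟨hn.ne'⟩
  have ha0 : 0 < a := by omega
  have han : a ≤ n := Nat.le_of_dvd hn hdvd
  obtain ⟨b, hb⟩ := hdvd
  have hpos : ∀ k, 1 ≤ k → k ≤ n → position (k : ZMod n) = k - 1 := by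
    intro k h1 h2
    obtain ⟨k, rfl⟩ := Nat.exists_eq_add_of_le' h1
    exact position_natCast_succ h2
  refine ⟨⟨?_, ?_, ?_⟩, ?_, ?_, ?_, ?_, ?_⟩
  · intro i j k
    have hj := columnOffset_add_reverse hb (position_lt j)
    have hk := columnOffset_add_reverse hb (position_lt k)
    simp only [divisorSquare, position_reverse, ← Nat.cast_add, Nat.cast_inj]
    omega
  · have hrow : ∀ i : ZMod n, a * position i + a * (n - 1 - position i) = a * (n - 1) := by
      intro i
      have := position_lt i
      rw [← mul_add]
      congr 1
      omega
    intro i j k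
    have hi := hrow i
    have hk := hrow k
    simp only [divisorSquare, position_reverse, ← Nat.cast_add, Nat.cast_inj]
    omega
  · intro i j k l
    simp only [divisorSquare]
    push_cast
    ring
  · ext x
    constructor
    · rintro ⟨i, j, rfl⟩
      refine ⟨_, by omega, ?_, rfl⟩
      have hi := position_lt i
      have hmod := Nat.mod_lt (position j) ha0
      have hdiv : position j / a < b := Nat.div_lt_of_lt_mul (hb ▸ position_lt j)
      have h1 : a * (position i + 1) ≤ a * n := Nat.mul_le_mul_left _ hi
      have h2 : a * n * (position j / a + 1) ≤ a * n * b := Nat.mul_le_mul_left _ hdiv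
      have h3 : a * n * b = n ^ 2 := by rw [mul_right_comm, ← hb, sq]
      rw [columnOffset]
      nlinarith
    · rintro ⟨m, h1, h2, rfl⟩
      obtain ⟨m, rfl⟩ := Nat.exists_eq_add_of_le h1
      have hs : m / a < n * b := by
        apply Nat.div_lt_of_lt_mul
        have : a * (n * b) = n ^ 2 := by rw [mul_left_comm, ← hb, sq]
        omega
      have hq : m / a / n < b := Nat.div_lt_of_lt_mul hs
      have hmod := Nat.mod_lt m ha0
      have ht : m % a + a * (m / a / n) < n := by
        have : a * (m / a / n + 1) ≤ a * b := Nat.mul_le_mul_left _ hq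
        rw [← hb] at this
        nlinarith
      refine ⟨((m / a % n + 1 : ℕ) : ZMod n), ((m % a + a * (m / a / n) + 1 : ℕ) : ZMod n), ?_⟩
      rw [divisorSquare, position_natCast_succ (Nat.mod_lt _ hn), position_natCast_succ ht,
        columnOffset, Nat.add_mul_mod_self_left, Nat.mod_eq_of_lt hmod,
        Nat.add_mul_div_left _ _ ha0, Nat.div_eq_of_lt hmod, zero_add]
      congr 1
      have e1 := Nat.mod_add_div m a
      have e2 := Nat.mod_add_div (m / a) n
      calc 1 + m = 1 + (m % a + a * (m / a % n + n * (m / a / n))) := by rw [e2, e1]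
        _ = _ := by ring
  · intro i k l h1 h2 h3
    have := columnOffset_strictMono hn ha0 (show k - 1 < l - 1 by omega)
    simp only [divisorSquare, hpos k h1 (by omega), hpos l (by omega) h3]
    exact_mod_cast Nat.add_lt_add_left this _
  · intro j k l h1 h2 h3
    have : a * (k - 1) < a * (l - 1) := Nat.mul_lt_mul_of_pos_left (by omega) ha0
    simp only [divisorSquare, hpos k h1 (by omega), hpos l (by omega) h3]
    norm_cast
    omega
  · have := hpos 1 le_rfl (by omega)
    rw [Nat.cast_one] at this
    simp [divisorSquare, this, columnOffset]
  · have h1 := hpos 1 le_rfl (by omega)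
    have h2 := hpos 2 (by omega) (by omega)
    rw [Nat.cast_one] at h1
    rw [Nat.cast_ofNat] at h2
    simp only [divisorSquare, h1, h2, columnOffset, Nat.add_one_sub_one, Nat.sub_self,
      Nat.mod_eq_of_lt (show 1 < a by omega), Nat.div_eq_of_lt (show 1 < a by omega)]
    norm_num

/-- In the first row, at position `a`, the offsets are `a * n` and `a`. -/
theorem divisorSquare_ne {n a : ℕ} (ha : 0 < a) (han : a < n) :
    divisorSquare n a ≠ divisorSquare n n := by
  intro h
  have h1 := congrFun (congrFun h ((0 + 1 : ℕ) : ZMod n)) ((a + 1 : ℕ) : ZMod n)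
  simp only [divisorSquare, columnOffset, position_natCast_succ (ha.trans han),
    position_natCast_succ han, Nat.mod_self, Nat.div_self ha, Nat.mod_eq_of_lt han,
    Nat.div_eq_of_lt han] at h1
  norm_cast at h1
  nlinarith

theorem IsPrincipalReversibleSquare.eq_divisorSquare {p : ℕ} (hp : p.Prime)
    {M : Matrix (ZMod p) (ZMod p) ℝ} (hM : IsPrincipalReversibleSquare M) :
    M = divisorSquare p p := by
  have : NeZero p := ⟨hp.ne_zero⟩
  have hnat : ∀ i j, ∃ m : ℕ, M i j = m + 1 ∧ m < p ^ 2 := by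
    intro i j
    obtain ⟨m, h1, h2, h3⟩ := hM.entries.subset ⟨i, j, rfl⟩
    obtain ⟨m, rfl⟩ := Nat.exists_eq_add_of_le' h1
    exact ⟨m, by rw [h3]; push_cast; rfl, h2⟩
  choose e he hlt using hnat
  let idx : Fin p → ZMod p := fun i => ((i + 1 : ℕ) : ZMod p)
  have hidx : ∀ x : ZMod p, idx ⟨position x, position_lt x⟩ = x := natCast_position_succ
  -- The cross sum with the corner `(1, 1)` reduces the square to its first column and first row.
  have hadd : ∀ i j, e i j = e i 1 + e 1 j := by
    intro i j
    have h := hM.cross_sum i j 1 1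
    rw [hM.first_entry, he i j, he i 1, he 1 j] at h
    have h' : (e i j : ℝ) = e i 1 + e 1 j := by linarith
    exact_mod_cast h'
  have hf : StrictMono fun i => e (idx i) 1 := by
    intro i j hij
    have h := hM.col_increasing 1 (i + 1) (j + 1) (by omega) (Nat.succ_lt_succ hij) j.2
    rw [he, he] at h
    exact_mod_cast (add_lt_add_iff_right (1 : ℝ)).1 h
  have hg : StrictMono fun j => e 1 (idx j) := by
    intro i j hij
    have h := hM.row_increasing 1 (i + 1) (j + 1) (by omega) (Nat.succ_lt_succ hij) j.2
    rw [he, he] at h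
    exact_mod_cast (add_lt_add_iff_right (1 : ℝ)).1 h
  have hg1 : ∃ j, e 1 (idx j) = 1 := by
    refine ⟨⟨position 2, position_lt 2⟩, ?_⟩
    rw [hidx]
    have h := hM.second_entry
    rw [he] at h
    have h' : (e 1 2 : ℝ) = 1 := by linarith
    exact_mod_cast h'
  have hsurj : ∀ m < p ^ 2, ∃ i j, e (idx i) 1 + e 1 (idx j) = m := by
    intro m hm
    obtain ⟨i, j, hij⟩ := hM.entries.superset ⟨m + 1, by omega, hm, rfl⟩
    refine ⟨⟨position i, position_lt i⟩, ⟨position j, position_lt j⟩, ?_⟩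
    rw [hidx, hidx, ← hadd]
    rw [he] at hij
    exact_mod_cast (add_right_cancel (by exact_mod_cast hij : (m : ℝ) + 1 = e i j + 1)).symm
  obtain ⟨hf', hg'⟩ := eq_of_bijOn_add hp hf hg hg1 (fun i j => hadd _ _ ▸ hlt _ _) hsurj
  ext i j
  have h1 := hf' ⟨position i, position_lt i⟩
  have h2 := hg' ⟨position j, position_lt j⟩
  rw [hidx] at h1 h2
  rw [he, hadd, h1, h2, divisorSquare, columnOffset, Nat.mod_eq_of_lt (position_lt j),
    Nat.div_eq_of_lt (position_lt j)]
  push_cast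
  ring

theorem mainTheorem5 (n : ℕ) (hn : 1 ≤ n) :
    numPrincipalReversibleSquares n = 1 ↔ n.Prime := by
  rw [numPrincipalReversibleSquares, Set.ncard_eq_one]
  constructor
  · rintro ⟨M, hM⟩
    have huniq : ∀ N, IsPrincipalReversibleSquare N → N = M := fun N hN => hM.subset hN
    have hn2 : 2 ≤ n := by
      by_contra hlt
      obtain rfl : n = 1 := by omega
      have hM' : IsPrincipalReversibleSquare M := hM.superset rfl
      have h := hM'.second_entry
      rw [Subsingleton.elim (2 : ZMod 1) 1, hM'.first_entry] at h
      norm_num at h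
    refine Nat.prime_def.2 ⟨hn2, fun a ha => ?_⟩
    by_contra! hne
    have ha0 := Nat.pos_of_dvd_of_pos ha hn
    have han := lt_of_le_of_ne (Nat.le_of_dvd hn ha) hne.2
    exact divisorSquare_ne ha0 han <|
      (huniq _ (divisorSquare_isPrincipal hn (by omega) ha)).trans
        (huniq _ (divisorSquare_isPrincipal hn hn2 dvd_rfl)).symm
  · intro hp
    refine ⟨divisorSquare n n, Set.eq_singleton_iff_unique_mem.2
      ⟨divisorSquare_isPrincipal hn hp.two_le dvd_rfl, fun M hM => hM.eq_divisorSquare hp⟩⟩
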